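/- Let $Q\subset\mathbb R^n$ be a (nondegenerate) cube with sides parallel to the axes and let $0<p_0<\infty$. A weight on $Q$ is an a.e. positive function in $L^1(Q)$. Write $M_Qf(x)=\sup\frac1{|Q'|}\int_{Q'}|f|\,dy$, the supremum being over the cubes $Q'\subseteq Q$ (sides parallel to the axes) that contain $x$. Let $A_1(Q)$ be the class of weights $w$ on $Q$ for which there is a constant $C$ with $M_Qw\le Cw$ a.e. on $Q$; for $1<p<\infty$ let $A_p(Q)$ be the class of weights $w$ on $Q$ with $$\sup_{Q'\subseteq Q}\Big(\frac1{|Q'|}\int_{Q'}w\,dx\Big)\Big(\frac1{|Q'|}\int_{Q'}w^{-1/(p-1)}\,dx\Big)^{p-1}<\infty,$$ the supremum being over cubes $Q'\subseteq Q$; and let $A_\infty(Q)=\bigcup_{1\le p<\infty}A_p(Q)$. For $r>0$ let $\mathcal M^r_{A_1}(Q)$ be the set of measurable functions $f$ on $Q$ for which there is $w\in A_1(Q)$ with $|f|^r\le w$ a.e. on $Q$. For $0<p<\infty$ and a weight $w$, let $L^p(Q)$ and $L^p_w(Q)$ be the sets of measurable $f$ on $Q$ with $\int_Q|f|^p\,dx<\infty$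 and $\int_Q|f|^pw\,dx<\infty$, respectively. Then $$\bigcup_{r>0}\mathcal M^r_{A_1}(Q)=\bigcup_{0<p<\infty}L^p(Q)=\bigcup_{w\in A_\infty(Q)}L^{p_0}_w(Q).$$ -/

import Mathlib

open MeasureTheory
open scoped ENNReal NNReal

namespace LocalWeights

/-- A (closed, nondegenerate) cube in `ℝⁿ` with sides parallel to the axes. -/
def IsCube {n : ℕ} (Q : Set (Fin n → ℝ)) : Prop :=
  ∃ (a : Fin n → ℝ) (l : ℝ), 0 < l ∧ Q = Set.Icc a (fun i => a i + l)

/-- A weight on `Q`: an (a.e.) positive function in `L¹(Q)`. -/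
structure IsWeight {n : ℕ} (Q : Set (Fin n → ℝ)) (w : (Fin n → ℝ) → ℝ) : Prop where
  integrableOn : IntegrableOn w Q volume
  pos : ∀ᵐ x ∂(volume.restrict Q), 0 < w x

/-- The (uncentred) Hardy-Littlewood maximal function restricted to `Q`: the supremum of the
averages of `|f|` over the cubes `Q' ⊆ Q` that contain `x`. -/
noncomputable def maximal {n : ℕ} (Q : Set (Fin n → ℝ)) (f : (Fin n → ℝ) → ℝ)
    (x : Fin n → ℝ) : ℝ≥0∞ :=
  ⨆ (Q' : Set (Fin n → ℝ)) (_ : IsCube Q') (_ : Q' ⊆ Q) (_ : x ∈ Q'),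
    (volume Q')⁻¹ * ∫⁻ y in Q', ‖f y‖ₑ

/-- The class `A₁(Q)`: weights `w` on `Q` with `M_Q w ≤ C w` a.e. on `Q`. -/
def A1 {n : ℕ} (Q : Set (Fin n → ℝ)) : Set ((Fin n → ℝ) → ℝ) :=
  {w | IsWeight Q w ∧
    ∃ C : ℝ≥0, ∀ᵐ x ∂(volume.restrict Q), maximal Q w x ≤ C * ENNReal.ofReal (w x)}

/-- The Muckenhoupt class `A_p(Q)`, `1 ≤ p < ∞`. For `p > 1` the condition is
`(⨍_{Q'} w) (⨍_{Q'} w ^ (1 - p')) ^ (p - 1) ≤ C` for all cubes `Q' ⊆ Q`, where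
`1 - p' = -1 / (p - 1)`. -/
def A {n : ℕ} (p : ℝ) (Q : Set (Fin n → ℝ)) : Set ((Fin n → ℝ) → ℝ) :=
  {w | (p = 1 ∧ w ∈ A1 Q) ∨
    (1 < p ∧ IsWeight Q w ∧ ∃ C : ℝ≥0, ∀ Q' : Set (Fin n → ℝ), IsCube Q' → Q' ⊆ Q →
      ((volume Q')⁻¹ * ∫⁻ y in Q', ENNReal.ofReal (w y)) *
        ((volume Q')⁻¹ * ∫⁻ y in Q', ENNReal.ofReal (w y) ^ (-1 / (p - 1))) ^ (p - 1) ≤ C)}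

/-- `A_∞(Q)`, the union of the classes `A_p(Q)`, `1 ≤ p < ∞`. -/
def AInfty {n : ℕ} (Q : Set (Fin n → ℝ)) : Set ((Fin n → ℝ) → ℝ) :=
  ⋃ (p : ℝ) (_ : 1 ≤ p), A p Q

/-- `L^p(Q)`, `0 < p < ∞`, as a set of functions. Only the values on `Q` matter. -/
def LpClass {n : ℕ} (𝕜 : Type*) [RCLike 𝕜] (p : ℝ) (Q : Set (Fin n → ℝ)) :
    Set ((Fin n → ℝ) → 𝕜) :=
  {f | MemLp f (ENNReal.ofReal p) (volume.restrict Q)}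

/-- The weighted space `L^p_w(Q)`, `0 < p < ∞`: measurable `f` on `Q` with
`∫_Q |f|^p w dx < ∞`. -/
def WeightedLpClass {n : ℕ} (𝕜 : Type*) [RCLike 𝕜] (p : ℝ) (w : (Fin n → ℝ) → ℝ)
    (Q : Set (Fin n → ℝ)) : Set ((Fin n → ℝ) → 𝕜) :=
  {f | AEStronglyMeasurable f (volume.restrict Q) ∧
    ∫⁻ x in Q, ‖f x‖ₑ ^ p * ENNReal.ofReal (w x) < ∞}

/-- The class `M^r_{A₁}(Q)`: measurable `f` on `Q` such that `|f|^r` has an `A₁(Q)` majorant. -/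
def A1Majorized {n : ℕ} (𝕜 : Type*) [RCLike 𝕜] (r : ℝ) (Q : Set (Fin n → ℝ)) :
    Set ((Fin n → ℝ) → 𝕜) :=
  {f | AEStronglyMeasurable f (volume.restrict Q) ∧
    ∃ w ∈ A1 Q, ∀ᵐ x ∂(volume.restrict Q), ‖f x‖ ^ r ≤ w x}

end LocalWeights

/-!
The unions agree because each of the three conditions on `f` is a power condition: passing from one
class to the next only costs a change of the exponent.

The inclusion with content is `L^p ⊆ M^{p/2}_{A₁}`. The function `h = |f| ^ (p / 2) + 1` lies in
`L²(Q)`, where the maximal operator is bounded, so the series `∑ K⁻ᵏ Tᵏ h` of Rubio de Francia is an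
integrable `A₁` majorant of `h` (`exists_A1_majorant`). Here `T` is not the maximal operator over the
cubes inside `Q` but one over a countable family of balls, which dominates it up to the factor `2 ^ n`
(`average_cube_le`) and is measurable for trivial reasons. Its weak type (1,1) inequality comes from
the Vitali covering lemma (`mul_volume_lt_ballMax_le`), and its `L²` bound from the layer cake formula
(`lintegral_sq_ballMax_le`).

If `|f| ^ r ≤ w` with `w ∈ A₁(Q)`, then `w ^ (-s) ∈ A_{1+s}(Q)` for every `s > 0`
(`rpow_neg_mem_A`), and for `s = p₀ / r` the product `|f| ^ p₀ * w ^ (-s)` is at most `1`. Conversely,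
if `w ∈ A_p(Q)` and `|f| ^ p₀ * w` is integrable, then so is `|f| ^ (p₀ / p)`, because a negative power
of `w` is integrable on `Q` or, for `p = 1`, because `w` is bounded below
(`mem_LpClass_of_mem_WeightedLpClass`).
-/

namespace LocalWeights

open Set Metric

variable {n : ℕ} {ι : Type*}

/-! ### A maximal operator over countably many balls -/

/-- The maximal operator of averages `|B|⁻¹ ∫_B g dμ` over the sup-norm balls
`B = closedBall (c i) (r i)` that contain the point. The averages are normalised by Lebesgue
measure, whatever `μ` is, so that `μ` may be the restriction of Lebesgue measure to a cube. -/
noncomputable def ballMax (c : ι → Fin n → ℝ) (r : ι → ℝ) (μ : Measure (Fin n → ℝ))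
    (g : (Fin n → ℝ) → ℝ≥0∞) (x : Fin n → ℝ) : ℝ≥0∞ :=
  ⨆ i, (closedBall (c i) (r i)).indicator
    (fun _ => (volume (closedBall (c i) (r i)))⁻¹ * ∫⁻ y in closedBall (c i) (r i), g y ∂μ) x

theorem measurable_ballMax [Countable ι] (c : ι → Fin n → ℝ) (r : ι → ℝ)
    (μ : Measure (Fin n → ℝ)) (g : (Fin n → ℝ) → ℝ≥0∞) : Measurable (ballMax c r μ g) :=
  Measurable.iSup fun _ => measurable_const.indicator isClosed_closedBall.measurableSet

theorem ballMax_le {c : ι → Fin n → ℝ} {r : ι → ℝ} {μ : Measure (Fin n → ℝ)}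
    {g : (Fin n → ℝ) → ℝ≥0∞} {x : Fin n → ℝ} {t : ℝ≥0∞}
    (h : ∀ i, x ∈ closedBall (c i) (r i) → (volume (closedBall (c i) (r i)))⁻¹ *
      ∫⁻ y in closedBall (c i) (r i), g y ∂μ ≤ t) : ballMax c r μ g x ≤ t := by
  refine iSup_le fun i => ?_
  by_cases hx : x ∈ closedBall (c i) (r i)
  · simpa [indicator_of_mem hx] using h i hx
  · simp [indicator_of_notMem hx]

theorem le_ballMax {c : ι → Fin n → ℝ} {r : ι → ℝ} (μ : Measure (Fin n → ℝ))
    (g : (Fin n → ℝ) → ℝ≥0∞) {x : Fin n → ℝ} {i : ι} (hx : x ∈ closedBall (c i) (r i)) :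
    (volume (closedBall (c i) (r i)))⁻¹ * ∫⁻ y in closedBall (c i) (r i), g y ∂μ
      ≤ ballMax c r μ g x := by
  refine le_trans ?_ (le_iSup _ i)
  rw [indicator_of_mem hx]

theorem ballMax_tsum_mul_le (c : ι → Fin n → ℝ) (r : ι → ℝ) (μ : Measure (Fin n → ℝ))
    (a : ℕ → ℝ≥0∞) {g : ℕ → (Fin n → ℝ) → ℝ≥0∞} (hg : ∀ k, Measurable (g k)) (x : Fin n → ℝ) :
    ballMax c r μ (fun y => ∑' k, a k * g k y) x ≤ ∑' k, a k * ballMax c r μ (g k) x := by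
  refine ballMax_le fun i hx => ?_
  rw [lintegral_tsum fun k => ((hg k).const_mul (a k)).aemeasurable, ← ENNReal.tsum_mul_left]
  refine ENNReal.tsum_le_tsum fun k => ?_
  rw [lintegral_const_mul _ (hg k), mul_left_comm]
  gcongr
  exact le_ballMax μ (g k) hx

theorem ballMax_le_add {c : ι → Fin n → ℝ} {r : ι → ℝ} (hr : ∀ i, 0 < r i)
    {μ : Measure (Fin n → ℝ)} (hμ : μ ≤ volume) {g g' : (Fin n → ℝ) → ℝ≥0∞} {t : ℝ≥0∞}
    (hg : ∀ x, g x ≤ t + g' x) (x : Fin n → ℝ) :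
    ballMax c r μ g x ≤ t + ballMax c r μ g' x := by
  refine ballMax_le fun i hx => ?_
  set B := closedBall (c i) (r i) with hB
  have h0 : volume B ≠ 0 := (measure_closedBall_pos _ _ (hr i)).ne'
  have htop : volume B ≠ ∞ := measure_closedBall_lt_top.ne
  calc (volume B)⁻¹ * ∫⁻ y in B, g y ∂μ
      ≤ (volume B)⁻¹ * ∫⁻ y in B, (t + g' y) ∂μ := by gcongr with y; exact hg y
    _ = (volume B)⁻¹ * (t * μ B) + (volume B)⁻¹ * ∫⁻ y in B, g' y ∂μ := by
        rw [lintegral_add_left measurable_const, setLIntegral_const, mul_add]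
    _ ≤ (volume B)⁻¹ * (t * volume B) + ballMax c r μ g' x := by
        exact add_le_add (by gcongr) (le_ballMax μ g' hx)
    _ = t + ballMax c r μ g' x := by
        rw [mul_left_comm, ENNReal.inv_mul_cancel h0 htop, mul_one]

/-- The weak type (1,1) inequality, from the Vitali covering lemma. -/
theorem mul_volume_lt_ballMax_le [Countable ι] {c : ι → Fin n → ℝ} {r : ι → ℝ} {R : ℝ}
    (hr : ∀ i, 0 < r i) (hR : ∀ i, r i ≤ R) (μ : Measure (Fin n → ℝ))
    (g : (Fin n → ℝ) → ℝ≥0∞) (t : ℝ≥0∞) :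
    t * volume {x | t < ballMax c r μ g x} ≤ 5 ^ n * ∫⁻ x, g x ∂μ := by
  set B : ι → Set (Fin n → ℝ) := fun i => closedBall (c i) (r i) with hB
  set s : Set ι := {i | t * volume (B i) ≤ ∫⁻ y in B i, g y ∂μ} with hs
  obtain ⟨u, hus, hdisj, hcov⟩ := Vitali.exists_disjoint_subfamily_covering_enlargement_closedBall
    s c r R (fun i _ => hR i) 5 (by norm_num)
  have hsub : {x | t < ballMax c r μ g x} ⊆ ⋃ i ∈ u, closedBall (c i) (5 * r i) := by
    intro x hx
    obtain ⟨i, hi⟩ := lt_iSup_iff.1 (show t < ⨆ i, _ from hx)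
    have hxi : x ∈ B i := by
      by_contra hxi
      rw [indicator_of_notMem hxi] at hi
      exact not_lt_zero hi
    rw [indicator_of_mem hxi] at hi
    have his : i ∈ s := by
      have h0 : volume (B i) ≠ 0 := (measure_closedBall_pos _ _ (hr i)).ne'
      have htop : volume (B i) ≠ ∞ := measure_closedBall_lt_top.ne
      rw [mul_comm, ← div_eq_mul_inv] at hi
      exact (ENNReal.le_div_iff_mul_le (Or.inl h0) (Or.inl htop)).1 hi.le
    obtain ⟨j, hj, hij⟩ := hcov i his
    exact mem_biUnion hj (hij hxi)
  have hvol : ∀ i, volume (closedBall (c i) (5 * r i)) = 5 ^ n * volume (B i) := by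
    intro i
    rw [hB, Real.volume_pi_closedBall _ (by linarith [hr i]),
      Real.volume_pi_closedBall _ (hr i).le, Fintype.card_fin, mul_left_comm, mul_pow,
      ENNReal.ofReal_mul (by positivity), ENNReal.ofReal_pow (by norm_num)]
    norm_num
  have hu : u.Countable := u.to_countable
  calc t * volume {x | t < ballMax c r μ g x}
      ≤ t * ∑' i : u, volume (closedBall (c i) (5 * r i)) := by
        gcongr
        exact (measure_mono hsub).trans (measure_biUnion_le _ hu _)
    _ = 5 ^ n * ∑' i : u, t * volume (B i) := by
        simp_rw [hvol, ENNReal.tsum_mul_left]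
        ring
    _ ≤ 5 ^ n * ∑' i : u, ∫⁻ y in B i, g y ∂μ := by
        gcongr with i
        exact hus i.2
    _ = 5 ^ n * ∫⁻ y in ⋃ i ∈ u, B i, g y ∂μ := by
        rw [lintegral_biUnion hu (fun i _ => isClosed_closedBall.measurableSet) hdisj]
    _ ≤ 5 ^ n * ∫⁻ x, g x ∂μ := by
        gcongr
        exact Measure.restrict_le_self

/-- The layer cake formula for `a ^ 2`, the only inequality that is needed. -/
theorem sq_le_lintegral_indicator (a : ℝ≥0∞) :
    a ^ 2 ≤ 2 * ∫⁻ t in Ioi (0 : ℝ), {t : ℝ | ENNReal.ofReal t < a}.indicator ENNReal.ofReal t := by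
  induction a with
  | top =>
    have : (∞ : ℝ≥0∞) ≤ ∫⁻ t in Ioi (0 : ℝ),
        {t : ℝ | ENNReal.ofReal t < ∞}.indicator ENNReal.ofReal t := by
      calc (∞ : ℝ≥0∞) = ∫⁻ t in Ioi (1 : ℝ), 1 := by simp
        _ ≤ ∫⁻ t in Ioi (1 : ℝ), {t : ℝ | ENNReal.ofReal t < ∞}.indicator ENNReal.ofReal t := by
          refine setLIntegral_mono' measurableSet_Ioi fun t ht => ?_
          simpa [indicator] using le_of_lt ht
        _ ≤ _ := lintegral_mono_set (Ioi_subset_Ioi zero_le_one)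
    rw [top_le_iff.1 this]
    simp
  | coe a =>
    have h : ∫⁻ t in Ioc (0 : ℝ) a, ENNReal.ofReal t = ENNReal.ofReal (a ^ 2 / 2) := by
      rw [← ofReal_integral_eq_lintegral_ofReal, ← intervalIntegral.integral_of_le a.coe_nonneg,
        integral_id]
      · simp
      · exact (continuous_id.integrableOn_Icc).mono_set Ioc_subset_Icc_self
      · exact (ae_restrict_iff' measurableSet_Ioc).2 (ae_of_all _ fun t ht => ht.1.le)
    calc (a : ℝ≥0∞) ^ 2 = 2 * ENNReal.ofReal (a ^ 2 / 2) := by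
          rw [show (2 : ℝ≥0∞) = ENNReal.ofReal 2 by simp, ← ENNReal.ofReal_mul (by norm_num),
            mul_div_cancel₀ _ two_ne_zero, ENNReal.ofReal_pow a.coe_nonneg, ENNReal.ofReal_coe_nnreal]
      _ = 2 * ∫⁻ t in Ioo (0 : ℝ) a, ENNReal.ofReal t := by
          rw [← h, setLIntegral_congr Ioo_ae_eq_Ioc]
      _ ≤ 2 * ∫⁻ t in Ioo (0 : ℝ) a,
            {t : ℝ | ENNReal.ofReal t < a}.indicator ENNReal.ofReal t := by
          gcongr 2 * ?_
          refine setLIntegral_mono' measurableSet_Ioo fun t ht => ?_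
          rw [indicator_of_mem]
          rw [mem_ofPred_eq, ← ENNReal.ofReal_coe_nnreal]
          exact (ENNReal.ofReal_lt_ofReal_iff (ht.1.trans ht.2)).2 ht.2
      _ ≤ _ := by
          gcongr 2 * ?_
          exact lintegral_mono_set Ioo_subset_Ioi_self

theorem lintegral_indicator_ofReal_lt_le (a : ℝ≥0∞) :
    ∫⁻ t in Ioi (0 : ℝ), {t : ℝ | ENNReal.ofReal t < a}.indicator 1 t ≤ a := by
  induction a with
  | top => exact le_top
  | coe a =>
    calc ∫⁻ t in Ioi (0 : ℝ), {t : ℝ | ENNReal.ofReal t < a}.indicator 1 t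
        ≤ ∫⁻ t in Ioi (0 : ℝ), (Iio (a : ℝ)).indicator 1 t := by
          gcongr
          intro t ht
          rw [mem_ofPred_eq, ← ENNReal.ofReal_coe_nnreal] at ht
          exact ENNReal.ofReal_lt_ofReal_iff'.1 ht |>.1
      _ = a := by
          rw [lintegral_indicator_one measurableSet_Iio, Measure.restrict_apply measurableSet_Iio,
            inter_comm, Ioi_inter_Iio]
          simp

/-- The `L²` bound, by Marcinkiewicz interpolation: the weak type (1,1) inequality at height `t / 2`
is applied to the part of `g` that exceeds `t / 2`. -/
theorem lintegral_sq_ballMax_le [Countable ι] {c : ι → Fin n → ℝ} {r : ι → ℝ} {R : ℝ}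
    (hr : ∀ i, 0 < r i) (hR : ∀ i, r i ≤ R) {μ : Measure (Fin n → ℝ)} [SFinite μ]
    (hμ : μ ≤ volume) {g : (Fin n → ℝ) → ℝ≥0∞} (hg : Measurable g) :
    ∫⁻ x, ballMax c r μ g x ^ 2 ∂μ ≤ (8 * 5 ^ n) * ∫⁻ x, g x ^ 2 ∂μ := by
  have hT := measurable_ballMax c r μ g
  have hlt : ∀ {F : (Fin n → ℝ) → ℝ≥0∞}, Measurable F →
      MeasurableSet {p : (Fin n → ℝ) × ℝ | ENNReal.ofReal p.2 < F p.1} := fun hF =>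
    measurableSet_lt (ENNReal.measurable_ofReal.comp measurable_snd) (hF.comp measurable_fst)
  have hlevel : ∀ t ∈ Ioi (0 : ℝ), ENNReal.ofReal t * μ {x | ENNReal.ofReal t < ballMax c r μ g x}
      ≤ 2 * 5 ^ n * ∫⁻ x, {x | ENNReal.ofReal t < 2 * g x}.indicator g x ∂μ := by
    intro t ht
    set s := ENNReal.ofReal (t / 2) with hs
    have hst : ENNReal.ofReal t = 2 * s := by
      rw [hs, show (2 : ℝ≥0∞) = ENNReal.ofReal 2 by simp, ← ENNReal.ofReal_mul (by norm_num)]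
      congr 1
      ring
    have hs_ne_top : s ≠ ∞ := ENNReal.ofReal_ne_top
    set g' := {x | ENNReal.ofReal t < 2 * g x}.indicator g with hg'
    have hgg' : ∀ x, g x ≤ s + g' x := by
      intro x
      by_cases hx : x ∈ {x | ENNReal.ofReal t < 2 * g x}
      · rw [hg', indicator_of_mem hx]
        exact le_add_self
      · rw [mem_ofPred_eq, hst, not_lt,
          ENNReal.mul_le_mul_iff_right two_ne_zero ENNReal.ofNat_ne_top] at hx
        exact hx.trans le_self_add
    have hsub : {x | ENNReal.ofReal t < ballMax c r μ g x} ⊆ {x | s < ballMax c r μ g' x} := by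
      intro x hx
      have := lt_of_lt_of_le hx (ballMax_le_add hr hμ hgg' x)
      rw [hst, two_mul] at this
      exact lt_of_add_lt_add_left this
    calc ENNReal.ofReal t * μ {x | ENNReal.ofReal t < ballMax c r μ g x}
        ≤ 2 * s * volume {x | s < ballMax c r μ g' x} := by
          rw [hst] at hsub ⊢
          gcongr 2 * s * ?_
          exact (measure_mono hsub).trans (hμ _)
      _ ≤ 2 * 5 ^ n * ∫⁻ x, g' x ∂μ := by
          rw [mul_assoc, mul_assoc]
          gcongr 2 * ?_
          exact mul_volume_lt_ballMax_le hr hR μ g' s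
  calc ∫⁻ x, ballMax c r μ g x ^ 2 ∂μ
      ≤ ∫⁻ x, (2 * ∫⁻ t in Ioi (0 : ℝ),
          {t : ℝ | ENNReal.ofReal t < ballMax c r μ g x}.indicator ENNReal.ofReal t) ∂μ := by
        gcongr with x
        exact sq_le_lintegral_indicator _
    _ = 2 * ∫⁻ x, (∫⁻ t in Ioi (0 : ℝ),
          {p : (Fin n → ℝ) × ℝ | ENNReal.ofReal p.2 < ballMax c r μ g p.1}.indicator
            (fun p => ENNReal.ofReal p.2) (x, t)) ∂μ := by
        rw [lintegral_const_mul' _ _ ENNReal.ofNat_ne_top]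
        rfl
    _ = 2 * ∫⁻ t in Ioi (0 : ℝ), ∫⁻ x,
          {p : (Fin n → ℝ) × ℝ | ENNReal.ofReal p.2 < ballMax c r μ g p.1}.indicator
            (fun p => ENNReal.ofReal p.2) (x, t) ∂μ := by
        rw [lintegral_lintegral_swap]
        exact ((ENNReal.measurable_ofReal.comp measurable_snd).indicator (hlt hT)).aemeasurable
    _ = 2 * ∫⁻ t in Ioi (0 : ℝ),
          ENNReal.ofReal t * μ {x | ENNReal.ofReal t < ballMax c r μ g x} := by
        congr 2
        ext t
        rw [← lintegral_indicator_const (measurableSet_lt measurable_const hT)]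
        rfl
    _ ≤ 2 * ∫⁻ t in Ioi (0 : ℝ),
          2 * 5 ^ n * ∫⁻ x, {x | ENNReal.ofReal t < 2 * g x}.indicator g x ∂μ := by
        gcongr 2 * ?_
        exact setLIntegral_mono' measurableSet_Ioi hlevel
    _ = 2 * (2 * 5 ^ n * ∫⁻ t in Ioi (0 : ℝ), ∫⁻ x,
          {p : (Fin n → ℝ) × ℝ | ENNReal.ofReal p.2 < 2 * g p.1}.indicator
            (fun p => g p.1) (x, t) ∂μ) := by
        rw [lintegral_const_mul' _ _ (by finiteness)]
        rfl
    _ = 2 * (2 * 5 ^ n * ∫⁻ x, (∫⁻ t in Ioi (0 : ℝ),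
          {p : (Fin n → ℝ) × ℝ | ENNReal.ofReal p.2 < 2 * g p.1}.indicator
            (fun p => g p.1) (x, t)) ∂μ) := by
        rw [lintegral_lintegral_swap]
        exact (((hg.comp measurable_fst).indicator (hlt (hg.const_mul 2))).comp
          measurable_swap).aemeasurable
    _ ≤ 2 * (2 * 5 ^ n * ∫⁻ x, g x * (2 * g x) ∂μ) := by
        gcongr with x
        calc _ = ∫⁻ t in Ioi (0 : ℝ), g x * {t : ℝ | ENNReal.ofReal t < 2 * g x}.indicator 1 t := by
              congr 1
              ext t
              simp [indicator]
          _ = g x * ∫⁻ t in Ioi (0 : ℝ), {t : ℝ | ENNReal.ofReal t < 2 * g x}.indicator 1 t :=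
              lintegral_const_mul _ (measurable_one.indicator
                (measurableSet_lt ENNReal.measurable_ofReal measurable_const))
          _ ≤ _ := by
              gcongr
              exact lintegral_indicator_ofReal_lt_le _
    _ = (8 * 5 ^ n) * ∫⁻ x, g x ^ 2 ∂μ := by
        simp_rw [mul_left_comm (g _) 2, ← pow_two]
        rw [lintegral_const_mul' _ _ ENNReal.ofNat_ne_top]
        ring

/-! ### Comparison with the maximal function over cubes -/

/-- For `n = 0` the side length of a cube is not determined by the cube, so a side length of at most
`L` has to be chosen. -/
theorem IsCube.exists_side_le {Q' : Set (Fin n → ℝ)} (hQ' : IsCube Q') {b : Fin n → ℝ} {L : ℝ}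
    (hL : 0 < L) (h : Q' ⊆ Icc b (fun i => b i + L)) :
    ∃ (a : Fin n → ℝ) (l : ℝ), 0 < l ∧ l ≤ L ∧ Q' = Icc a (fun i => a i + l) := by
  obtain ⟨a, l, hl, rfl⟩ := hQ'
  refine ⟨a, min l L, lt_min hl hL, min_le_right _ _, ?_⟩
  congr 1
  ext i
  have h1 := h (left_mem_Icc.2 fun i => by linarith : a ∈ Icc a fun i => a i + l)
  have h2 := h (right_mem_Icc.2 fun i => by linarith : (fun i => a i + l) ∈ Icc a fun i => a i + l)
  have h3 := h1.1 i
  have h4 := h2.2 i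
  simp only at h4
  rw [min_eq_left (by linarith)]

theorem volume_cube (a : Fin n → ℝ) (l : ℝ) :
    volume (Icc a fun i => a i + l) = ENNReal.ofReal l ^ n := by
  simp [Real.volume_Icc_pi]

theorem IsCube.volume_ne_zero {Q : Set (Fin n → ℝ)} (hQ : IsCube Q) : volume Q ≠ 0 := by
  obtain ⟨a, l, hl, rfl⟩ := hQ
  rw [volume_cube a l]
  exact pow_ne_zero _ (ENNReal.ofReal_pos.2 hl).ne'

theorem IsCube.isCompact {Q : Set (Fin n → ℝ)} (hQ : IsCube Q) : IsCompact Q := by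
  obtain ⟨a, l, hl, rfl⟩ := hQ
  exact isCompact_Icc

theorem IsCube.measurableSet {Q : Set (Fin n → ℝ)} (hQ : IsCube Q) : MeasurableSet Q :=
  hQ.isCompact.isClosed.measurableSet

theorem IsCube.volume_ne_top {Q : Set (Fin n → ℝ)} (hQ : IsCube Q) : volume Q ≠ ∞ :=
  hQ.isCompact.measure_lt_top.ne

/-- The balls with centre in a countable dense set and positive rational radius at most `R`. -/
abbrev BallIndex (R : ℝ) : Type := {p : ℕ × ℚ // 0 < (p.2 : ℝ) ∧ (p.2 : ℝ) ≤ R}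

/-- A countable maximal operator that dominates the maximal function on a cube of side `R`. -/
noncomputable def cubeMax (Q : Set (Fin n → ℝ)) (R : ℝ) :
    ((Fin n → ℝ) → ℝ≥0∞) → (Fin n → ℝ) → ℝ≥0∞ :=
  ballMax (fun i : BallIndex R => TopologicalSpace.denseSeq (Fin n → ℝ) i.1.1)
    (fun i => (i.1.2 : ℝ)) (volume.restrict Q)

/-- A cube is contained in a ball of the countable family of at most `2 ^ n` times its volume. -/
theorem average_cube_le {Q : Set (Fin n → ℝ)} {R l : ℝ} (hl : 0 < l) (hlR : l ≤ R)
    {a : Fin n → ℝ} (h : Icc a (fun i => a i + l) ⊆ Q) (g : (Fin n → ℝ) → ℝ≥0∞) {x : Fin n → ℝ}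
    (hx : x ∈ Icc a (fun i => a i + l)) :
    (volume (Icc a fun i => a i + l))⁻¹ * ∫⁻ y in Icc a (fun i => a i + l), g y
      ≤ 2 ^ n * cubeMax Q R g x := by
  set m : Fin n → ℝ := fun i => a i + l / 2 with hm
  obtain ⟨j, hj⟩ := (TopologicalSpace.denseRange_denseSeq (Fin n → ℝ)).exists_dist_lt m
    (show 0 < l / 4 by positivity)
  obtain ⟨q, hq1, hq2⟩ := exists_rat_btwn (show 3 * l / 4 < l by linarith)
  set i : BallIndex R := ⟨(j, q), by simp only; linarith, hq2.le.trans hlR⟩ with hi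
  set B := closedBall (TopologicalSpace.denseSeq (Fin n → ℝ) j) (q : ℝ) with hB
  set Q' := Icc a (fun i => a i + l) with hQ'
  have hsub : Q' ⊆ B := by
    intro y hy
    have hym : dist y m ≤ l / 2 := by
      refine (dist_pi_le_iff (by positivity)).2 fun k => ?_
      have h1 := hy.1 k
      have h2 := hy.2 k
      simp only at h2
      rw [Real.dist_eq, abs_le]
      constructor <;> simp only [hm] <;> linarith
    rw [hB, mem_closedBall]
    linarith [dist_triangle y m (TopologicalSpace.denseSeq (Fin n → ℝ) j)]
  have hq0 : (0 : ℝ) < q := by linarith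
  have hvol : volume B ≤ 2 ^ n * volume Q' := by
    rw [hB, hQ', volume_cube a l, Real.volume_pi_closedBall _ hq0.le, Fintype.card_fin,
      ENNReal.ofReal_pow (by positivity), ENNReal.ofReal_mul zero_le_two, mul_pow]
    simp only [ENNReal.ofReal_ofNat]
    gcongr
  have hinv : (volume Q')⁻¹ ≤ 2 ^ n * (volume B)⁻¹ := by
    have h2 : (2 : ℝ≥0∞) ^ n ≠ 0 := by positivity
    have h2' : (2 : ℝ≥0∞) ^ n ≠ ∞ := by finiteness
    calc (volume Q')⁻¹ = 2 ^ n * (2 ^ n * volume Q')⁻¹ := by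
          rw [ENNReal.mul_inv (Or.inl h2) (Or.inl h2'), ← mul_assoc,
            ENNReal.mul_inv_cancel h2 h2', one_mul]
      _ ≤ _ := by gcongr
  calc (volume Q')⁻¹ * ∫⁻ y in Q', g y
      ≤ 2 ^ n * (volume B)⁻¹ * ∫⁻ y in B, g y ∂(volume.restrict Q) := by
        gcongr ?_ * ?_
        rw [Measure.restrict_restrict isClosed_closedBall.measurableSet]
        exact lintegral_mono_set (subset_inter hsub h)
    _ ≤ 2 ^ n * cubeMax Q R g x := by
        rw [mul_assoc]
        gcongr
        exact le_ballMax (c := fun i : BallIndex R =>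
          TopologicalSpace.denseSeq (Fin n → ℝ) i.1.1) (r := fun i => (i.1.2 : ℝ))
          _ g (i := i) (hsub hx)

/-! ### Majorants in `A₁` -/

/-- The construction of Rubio de Francia: with `T = cubeMax Q L`, where `L` is the side of `Q`, the
series `∑ K⁻ᵏ Tᵏ h` is a majorant of `h`, and `T` maps it to at most `K` times itself. -/
theorem exists_A1_majorant {Q : Set (Fin n → ℝ)} (hQ : IsCube Q) {h : (Fin n → ℝ) → ℝ≥0∞}
    (hm : Measurable h) (h1 : ∀ x, h x ≠ 0) (h2 : ∫⁻ x in Q, h x ^ 2 ≠ ∞) :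
    ∃ w ∈ A1 Q, ∀ᵐ x ∂(volume.restrict Q), h x ≤ ENNReal.ofReal (w x) := by
  obtain ⟨b, L, hL, rfl⟩ := id hQ
  set Q := Icc b (fun i => b i + L) with hQdef
  set μ := volume.restrict Q with hμ
  set T := cubeMax Q L with hT
  set A : ℝ≥0∞ := 8 * 5 ^ n with hA
  -- `Tᵏ` has `L²` norm squared at most `Aᵏ`, so with `K = 2 A` the series is dominated by `∑ 2⁻ᵏ`.
  set K : ℝ≥0∞ := 2 * A with hK
  have hA0 : A ≠ 0 := by positivity
  have hA1 : 1 ≤ A := by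
    have : (1 : ℝ≥0∞) ≤ 5 ^ n := one_le_pow₀ (by norm_num)
    calc (1 : ℝ≥0∞) = 1 * 1 := (one_mul _).symm
      _ ≤ A := mul_le_mul' (by norm_num) this
  have hAtop : A ≠ ∞ := by finiteness
  have hK0 : K ≠ 0 := by positivity
  have hKtop : K ≠ ∞ := by finiteness
  have hTm : ∀ k, Measurable (T^[k] h) := by
    intro k
    cases k with
    | zero => exact hm
    | succ k =>
      rw [Function.iterate_succ_apply']
      exact measurable_ballMax _ _ _ _
  have hTsq : ∀ k, ∫⁻ x, (T^[k] h) x ^ 2 ∂μ ≤ A ^ k * ∫⁻ x, h x ^ 2 ∂μ := by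
    intro k
    induction k with
    | zero => simp
    | succ k ih =>
      rw [Function.iterate_succ_apply', pow_succ', mul_assoc]
      refine (lintegral_sq_ballMax_le (fun i => i.2.1) (fun i => i.2.2)
        Measure.restrict_le_self (hTm k)).trans ?_
      gcongr
  set W : (Fin n → ℝ) → ℝ≥0∞ := fun x => ∑' k, K⁻¹ ^ k * (T^[k] h) x with hW
  have hWm : Measurable W := Measurable.tsum fun k => (hTm k).const_mul _
  set J : ℝ≥0∞ := volume Q + ∫⁻ x, h x ^ 2 ∂μ with hJ
  have hJtop : J ≠ ∞ := ENNReal.add_ne_top.2 ⟨hQ.volume_ne_top, h2⟩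
  -- Integrability of the series needs no Minkowski inequality, as `a ≤ 1 + a ^ 2`.
  have hTint : ∀ k, ∫⁻ x, (T^[k] h) x ∂μ ≤ A ^ k * J := by
    intro k
    calc ∫⁻ x, (T^[k] h) x ∂μ ≤ ∫⁻ x, (1 + (T^[k] h) x ^ 2) ∂μ := by
          gcongr with x
          rcases le_total ((T^[k] h) x) 1 with hx | hx
          · exact hx.trans le_self_add
          · exact (le_self_pow₀ hx two_ne_zero).trans le_add_self
      _ = volume Q + ∫⁻ x, (T^[k] h) x ^ 2 ∂μ := by
          rw [lintegral_add_left measurable_const, lintegral_one, hμ, Measure.restrict_apply_univ]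
      _ ≤ A ^ k * volume Q + A ^ k * ∫⁻ x, h x ^ 2 ∂μ :=
          add_le_add (le_mul_of_one_le_left' (one_le_pow₀ hA1)) (hTsq k)
      _ = A ^ k * J := (mul_add _ _ _).symm
  have hWint : ∫⁻ x, W x ∂μ ≠ ∞ := by
    have hKA : K⁻¹ * A = 2⁻¹ := by
      rw [hK, ENNReal.mul_inv (Or.inl two_ne_zero) (Or.inl ENNReal.ofNat_ne_top), mul_assoc,
        ENNReal.inv_mul_cancel hA0 hAtop, mul_one]
    have : ∫⁻ x, W x ∂μ ≤ 2 * J := by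
      calc ∫⁻ x, W x ∂μ = ∑' k, K⁻¹ ^ k * ∫⁻ x, (T^[k] h) x ∂μ := by
            rw [hW, lintegral_tsum fun k => ((hTm k).const_mul _).aemeasurable]
            congr 1
            ext k
            rw [lintegral_const_mul _ (hTm k)]
        _ ≤ ∑' k, 2⁻¹ ^ k * J := by
            refine ENNReal.tsum_le_tsum fun k => ?_
            rw [← hKA, mul_pow, mul_assoc]
            gcongr
            exact hTint k
        _ = 2 * J := by
            rw [ENNReal.tsum_mul_right, ENNReal.tsum_geometric, ENNReal.one_sub_inv_two, inv_inv]
    exact ne_top_of_le_ne_top (ENNReal.mul_ne_top ENNReal.ofNat_ne_top hJtop) this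
  have hWfin : ∀ᵐ x ∂μ, W x < ∞ := ae_lt_top hWm hWint
  have hhW : ∀ x, h x ≤ W x := fun x => by
    simpa using ENNReal.le_tsum (f := fun k => K⁻¹ ^ k * (T^[k] h) x) 0
  have hTW : ∀ x, T W x ≤ K * W x := by
    intro x
    calc T W x ≤ ∑' k, K⁻¹ ^ k * T (T^[k] h) x := ballMax_tsum_mul_le _ _ _ _ hTm x
      _ = ∑' k, K * (K⁻¹ ^ (k + 1) * (T^[k + 1] h) x) := by
          congr 1
          ext k
          rw [Function.iterate_succ_apply', pow_succ', ← mul_assoc, ← mul_assoc,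
            ENNReal.mul_inv_cancel hK0 hKtop, one_mul]
      _ = K * ∑' k, K⁻¹ ^ (k + 1) * (T^[k + 1] h) x := ENNReal.tsum_mul_left
      _ ≤ K * W x := by
          gcongr
          exact ENNReal.tsum_comp_le_tsum_of_injective (add_left_injective 1)
            (fun k => K⁻¹ ^ k * (T^[k] h) x)
  have hWr : ∀ᵐ x ∂μ, ENNReal.ofReal (W x).toReal = W x := by
    filter_upwards [hWfin] with x hx using ENNReal.ofReal_toReal hx.ne
  refine ⟨fun x => (W x).toReal, ⟨⟨integrable_toReal_of_lintegral_ne_top hWm.aemeasurable hWint, ?_⟩,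
    (2 ^ n * K).toNNReal, ?_⟩, ?_⟩
  · filter_upwards [hWfin] with x hx
    exact ENNReal.toReal_pos ((pos_iff_ne_zero.2 (h1 x)).trans_le (hhW x)).ne' hx.ne
  · filter_upwards [hWr] with x hx
    rw [hx, ENNReal.coe_toNNReal (by finiteness)]
    refine iSup_le fun Q' => iSup_le fun hQ' => iSup_le fun hsub => iSup_le fun hxQ' => ?_
    obtain ⟨a, l, hl, hlL, rfl⟩ := hQ'.exists_side_le hL hsub
    calc _ = (volume (Icc a fun i => a i + l))⁻¹ * ∫⁻ y in Icc a (fun i => a i + l), W y := by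
          congr 1
          refine lintegral_congr_ae ?_
          filter_upwards [ae_restrict_of_ae_restrict_of_subset hsub hWr] with y hy
          rw [Real.enorm_of_nonneg ENNReal.toReal_nonneg, hy]
      _ ≤ 2 ^ n * T W x := average_cube_le hl hlL hsub W hxQ'
      _ ≤ 2 ^ n * K * W x := by
          rw [mul_assoc]
          gcongr
          exact hTW x
  · filter_upwards [hWr] with x hx
    rw [hx]
    exact hhW x

/-! ### Averages of weights -/

theorem IsWeight.aemeasurable_ofReal {Q : Set (Fin n → ℝ)} {w : (Fin n → ℝ) → ℝ}
    (hw : IsWeight Q w) : AEMeasurable (fun x => ENNReal.ofReal (w x)) (volume.restrict Q) :=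
  hw.integrableOn.aemeasurable.ennreal_ofReal

theorem IsWeight.lintegral_ne_top {Q : Set (Fin n → ℝ)} {w : (Fin n → ℝ) → ℝ}
    (hw : IsWeight Q w) : ∫⁻ x in Q, ENNReal.ofReal (w x) ≠ ∞ :=
  hw.integrableOn.lintegral_lt_top.ne

theorem IsWeight.mono {Q Q' : Set (Fin n → ℝ)} {w : (Fin n → ℝ) → ℝ} (hw : IsWeight Q w)
    (h : Q' ⊆ Q) : IsWeight Q' w :=
  ⟨hw.integrableOn.mono_set h, ae_restrict_of_ae_restrict_of_subset h hw.pos⟩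

theorem IsWeight.average_ne_zero {Q : Set (Fin n → ℝ)} (hQ : IsCube Q) {w : (Fin n → ℝ) → ℝ}
    (hw : IsWeight Q w) : (volume Q)⁻¹ * ∫⁻ x in Q, ENNReal.ofReal (w x) ≠ 0 := by
  refine mul_ne_zero (ENNReal.inv_ne_zero.2 hQ.volume_ne_top) fun h => ?_
  rw [lintegral_eq_zero_iff' hw.aemeasurable_ofReal] at h
  have : ∀ᵐ x ∂(volume.restrict Q), False := by
    filter_upwards [h, hw.pos] with x hx hx'
    exact (ENNReal.ofReal_pos.2 hx').ne' hx
  rw [ae_iff] at this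
  simp only [not_false_eq_true, ofPred_true, Measure.restrict_apply_univ] at this
  exact hQ.volume_ne_zero this

theorem IsWeight.average_ne_top {Q : Set (Fin n → ℝ)} (hQ : IsCube Q) {w : (Fin n → ℝ) → ℝ}
    (hw : IsWeight Q w) : (volume Q)⁻¹ * ∫⁻ x in Q, ENNReal.ofReal (w x) ≠ ∞ :=
  ENNReal.mul_ne_top (ENNReal.inv_ne_top.2 hQ.volume_ne_zero) hw.lintegral_ne_top

theorem exists_average_le_of_mem_A1 {Q : Set (Fin n → ℝ)} {w : (Fin n → ℝ) → ℝ} (hw : w ∈ A1 Q) :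
    ∃ C : ℝ≥0, ∀ Q' : Set (Fin n → ℝ), IsCube Q' → Q' ⊆ Q → ∀ᵐ x ∂(volume.restrict Q'),
      (volume Q')⁻¹ * ∫⁻ y in Q', ENNReal.ofReal (w y) ≤ C * ENNReal.ofReal (w x) := by
  obtain ⟨hw, C, hC⟩ := hw
  refine ⟨C, fun Q' hQ' hsub => ?_⟩
  filter_upwards [ae_restrict_of_ae_restrict_of_subset hsub hC,
    ae_restrict_mem hQ'.measurableSet] with x hx hxQ'
  refine le_trans ?_ hx
  have : ∫⁻ y in Q', ENNReal.ofReal (w y) ≤ ∫⁻ y in Q', ‖w y‖ₑ :=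
    lintegral_mono fun y => Real.ofReal_le_enorm _
  calc _ ≤ (volume Q')⁻¹ * ∫⁻ y in Q', ‖w y‖ₑ := by gcongr
    _ ≤ maximal Q w x := le_iSup_of_le Q' <| le_iSup_of_le hQ' <| le_iSup_of_le hsub <|
      le_iSup_of_le hxQ' le_rfl

/-- Negative powers of `A₁` weights are Muckenhoupt weights: on a cube, an `A₁` weight `w` is
bounded below by a multiple of its average, so that `w ^ (-s)` is bounded above. -/
theorem rpow_neg_mem_A {Q : Set (Fin n → ℝ)} (hQ : IsCube Q) {w : (Fin n → ℝ) → ℝ} (hw : w ∈ A1 Q)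
    {s : ℝ} (hs : 0 < s) : (fun x => w x ^ (-s)) ∈ A (1 + s) Q := by
  obtain ⟨C, hC⟩ := exists_average_le_of_mem_A1 hw
  have key : ∀ Q' : Set (Fin n → ℝ), IsCube Q' → Q' ⊆ Q →
      ((volume Q')⁻¹ * ∫⁻ y in Q', ENNReal.ofReal (w y ^ (-s))) *
        ((volume Q')⁻¹ * ∫⁻ y in Q', ENNReal.ofReal (w y)) ^ s ≤ (C ^ s : ℝ≥0) := by
    intro Q' hQ' hsub
    have hw' := hw.1.mono hsub
    set m := (volume Q')⁻¹ * ∫⁻ y in Q', ENNReal.ofReal (w y) with hm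
    have hmtop : m ^ s ≠ ∞ := ENNReal.rpow_ne_top_of_nonneg hs.le (hw'.average_ne_top hQ')
    rw [mul_assoc, ← lintegral_mul_const' _ _ hmtop]
    calc (volume Q')⁻¹ * ∫⁻ y in Q', ENNReal.ofReal (w y ^ (-s)) * m ^ s
        ≤ (volume Q')⁻¹ * ∫⁻ y in Q', (C ^ s : ℝ≥0) := by
          refine mul_le_mul_right (lintegral_mono_ae ?_) _
          filter_upwards [hC Q' hQ' hsub, hw'.pos] with y hy hpos
          have h0 : ENNReal.ofReal (w y) ^ s ≠ 0 :=
            (ENNReal.rpow_pos (ENNReal.ofReal_pos.2 hpos) ENNReal.ofReal_ne_top).ne'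
          have htop : ENNReal.ofReal (w y) ^ s ≠ ∞ :=
            ENNReal.rpow_ne_top_of_nonneg hs.le ENNReal.ofReal_ne_top
          calc ENNReal.ofReal (w y ^ (-s)) * m ^ s
              ≤ (ENNReal.ofReal (w y) ^ s)⁻¹ * (C * ENNReal.ofReal (w y)) ^ s := by
                rw [← ENNReal.ofReal_rpow_of_pos hpos, ENNReal.rpow_neg]
                gcongr
            _ = (C ^ s : ℝ≥0) := by
                rw [ENNReal.mul_rpow_of_nonneg _ _ hs.le, mul_left_comm,
                  ENNReal.inv_mul_cancel h0 htop, mul_one, ENNReal.coe_rpow_of_nonneg _ hs.le]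
      _ = (C ^ s : ℝ≥0) := by
          rw [setLIntegral_const, mul_left_comm,
            ENNReal.inv_mul_cancel hQ'.volume_ne_zero hQ'.volume_ne_top, mul_one]
  have hpos : ∀ᵐ x ∂(volume.restrict Q), 0 < w x ^ (-s) := by
    filter_upwards [hw.1.pos] with x hx using Real.rpow_pos_of_pos hx _
  have hint : ∫⁻ y in Q, ENNReal.ofReal (w y ^ (-s)) ≠ ∞ := by
    intro htop
    have h := key Q hQ subset_rfl
    have hm0 := (ENNReal.rpow_pos (pos_iff_ne_zero.2 (hw.1.average_ne_zero hQ))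
      (hw.1.average_ne_top hQ) (p := s)).ne'
    rw [htop, ENNReal.mul_top (ENNReal.inv_ne_zero.2 hQ.volume_ne_top), ENNReal.top_mul hm0] at h
    exact ENNReal.coe_ne_top (top_le_iff.1 h)
  refine Or.inr ⟨by linarith, ⟨⟨?_, ?_⟩, hpos⟩, C ^ s, fun Q' hQ' hsub => ?_⟩
  · exact (hw.1.integrableOn.aemeasurable.pow_const _).aestronglyMeasurable
  · rw [hasFiniteIntegral_iff_ofReal (hpos.mono fun x hx => hx.le)]
    exact hint.lt_top
  · rw [add_sub_cancel_left]
    convert key Q' hQ' hsub using 4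
    refine lintegral_congr_ae ?_
    filter_upwards [(hw.1.mono hsub).pos] with y hy
    rw [ENNReal.ofReal_rpow_of_pos (Real.rpow_pos_of_pos hy _), ← Real.rpow_mul hy.le]
    congr 1
    rw [show -s * (-1 / s) = 1 by field_simp, Real.rpow_one]

/-! ### The inclusions between the unions -/

variable {𝕜 : Type*} [RCLike 𝕜]

theorem mem_LpClass_iff {p : ℝ} (hp : 0 < p) {Q : Set (Fin n → ℝ)} {f : (Fin n → ℝ) → 𝕜} :
    f ∈ LpClass 𝕜 p Q ↔ AEStronglyMeasurable f (volume.restrict Q) ∧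
      ∫⁻ x in Q, ‖f x‖ₑ ^ p < ∞ := by
  rw [LpClass, mem_ofPred_eq, MemLp, eLpNorm_lt_top_iff_lintegral_rpow_enorm_lt_top
    (ENNReal.ofReal_pos.2 hp).ne' ENNReal.ofReal_ne_top, ENNReal.toReal_ofReal hp.le]

theorem mem_LpClass_of_mem_A1Majorized {r : ℝ} (hr : 0 < r) {Q : Set (Fin n → ℝ)}
    {f : (Fin n → ℝ) → 𝕜} (hf : f ∈ A1Majorized 𝕜 r Q) : f ∈ LpClass 𝕜 r Q := by
  obtain ⟨hfm, w, hw, hfw⟩ := hf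
  refine (mem_LpClass_iff hr).2 ⟨hfm, lt_of_le_of_lt ?_ hw.1.lintegral_ne_top.lt_top⟩
  refine lintegral_mono_ae ?_
  filter_upwards [hfw] with x hx
  rw [← ofReal_norm, ENNReal.ofReal_rpow_of_nonneg (norm_nonneg _) hr.le]
  exact ENNReal.ofReal_le_ofReal hx

/-- The exponent is halved so that `|f| ^ (p / 2)` lies in `L²`, where the maximal operator is
bounded. -/
theorem mem_A1Majorized_of_mem_LpClass {p : ℝ} (hp : 0 < p) {Q : Set (Fin n → ℝ)}
    (hQ : IsCube Q) {f : (Fin n → ℝ) → 𝕜} (hf : f ∈ LpClass 𝕜 p Q) :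
    f ∈ A1Majorized 𝕜 (p / 2) Q := by
  obtain ⟨hfm, hfp⟩ := (mem_LpClass_iff hp).1 hf
  have hg : AEMeasurable (fun x => ‖f x‖ₑ ^ (p / 2)) (volume.restrict Q) :=
    hfm.enorm.pow_const _
  set g := hg.mk with hg'
  have hgm : Measurable g := hg.measurable_mk
  -- The constant `1` is added so that the majorant is positive.
  obtain ⟨w, hw, hle⟩ := exists_A1_majorant hQ (h := fun x => g x + 1) (hgm.add_const 1)
    (by simp) (by
      have hsq : ∀ a : ℝ≥0∞, (a + 1) ^ 2 ≤ 4 * (a ^ 2 + 1) := by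
        intro a
        rcases le_total a 1 with h | h
        · calc (a + 1) ^ 2 ≤ (1 + 1) ^ 2 := by gcongr
            _ = 4 * 1 := by norm_num
            _ ≤ _ := by gcongr; exact le_add_self
        · calc (a + 1) ^ 2 ≤ (a + a) ^ 2 := by gcongr
            _ = 4 * a ^ 2 := by ring
            _ ≤ _ := by gcongr; exact le_self_add
      have hg2 : ∫⁻ x in Q, g x ^ 2 = ∫⁻ x in Q, ‖f x‖ₑ ^ p := by
        refine lintegral_congr_ae ?_
        filter_upwards [hg.ae_eq_mk] with x hx
        rw [hg', ← hx, ← ENNReal.rpow_natCast, ← ENNReal.rpow_mul]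
        congr 1
        push_cast
        ring
      refine ne_top_of_le_ne_top ?_ (lintegral_mono fun x => hsq (g x))
      rw [lintegral_const_mul' _ _ ENNReal.ofNat_ne_top, lintegral_add_right _ measurable_const,
        hg2, lintegral_one, Measure.restrict_apply_univ]
      exact ENNReal.mul_ne_top ENNReal.ofNat_ne_top
        (ENNReal.add_ne_top.2 ⟨hfp.ne, hQ.volume_ne_top⟩))
  refine ⟨hfm, w, hw, ?_⟩
  filter_upwards [hle, hg.ae_eq_mk, hw.1.pos] with x hx hgx hpos
  rw [← ENNReal.ofReal_le_ofReal_iff hpos.le,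
    ← ENNReal.ofReal_rpow_of_nonneg (norm_nonneg _) (by positivity), ofReal_norm]
  calc ‖f x‖ₑ ^ (p / 2) = g x := hgx
    _ ≤ g x + 1 := le_self_add
    _ ≤ _ := hx

theorem exists_mem_WeightedLpClass_of_mem_A1Majorized {r p₀ : ℝ} (hr : 0 < r) (hp₀ : 0 < p₀)
    {Q : Set (Fin n → ℝ)} (hQ : IsCube Q) {f : (Fin n → ℝ) → 𝕜} (hf : f ∈ A1Majorized 𝕜 r Q) :
    ∃ v ∈ AInfty Q, f ∈ WeightedLpClass 𝕜 p₀ v Q := by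
  obtain ⟨hfm, w, hw, hfw⟩ := hf
  have hs : 0 < p₀ / r := div_pos hp₀ hr
  refine ⟨fun x => w x ^ (-(p₀ / r)), ?_, hfm, ?_⟩
  · exact mem_iUnion₂.2 ⟨1 + p₀ / r, by linarith, rpow_neg_mem_A hQ hw hs⟩
  · calc ∫⁻ x in Q, ‖f x‖ₑ ^ p₀ * ENNReal.ofReal (w x ^ (-(p₀ / r)))
        ≤ ∫⁻ x in Q, 1 := by
          refine lintegral_mono_ae ?_
          filter_upwards [hfw, hw.1.pos] with x hx hpos
          rw [← ofReal_norm, ENNReal.ofReal_rpow_of_nonneg (norm_nonneg _) hp₀.le,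
            ← ENNReal.ofReal_mul (by positivity), ENNReal.ofReal_le_one]
          have hwp : 0 < w x ^ (p₀ / r) := Real.rpow_pos_of_pos hpos _
          rw [Real.rpow_neg hpos.le, ← div_eq_mul_inv, div_le_one hwp]
          calc ‖f x‖ ^ p₀ = (‖f x‖ ^ r) ^ (p₀ / r) := by
                rw [← Real.rpow_mul (norm_nonneg _)]
                congr 1
                field_simp
            _ ≤ w x ^ (p₀ / r) := by gcongr
      _ = volume Q := by simp
      _ < ∞ := hQ.volume_ne_top.lt_top

/-- For `p > 1` this is Young's inequality for `|f| ^ (p₀ / p) = (|f| ^ p₀ w) ^ (1 / p) *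
(w ^ (-1 / (p - 1))) ^ (1 - 1 / p)`, in the crude form that a weighted geometric mean is at most the
maximum. For `p = 1` the weight is bounded below. -/
theorem mem_LpClass_of_mem_WeightedLpClass {p p₀ : ℝ} (hp : 1 ≤ p) (hp₀ : 0 < p₀)
    {Q : Set (Fin n → ℝ)} (hQ : IsCube Q) {w : (Fin n → ℝ) → ℝ} (hw : w ∈ A p Q)
    {f : (Fin n → ℝ) → 𝕜} (hf : f ∈ WeightedLpClass 𝕜 p₀ w Q) : f ∈ LpClass 𝕜 (p₀ / p) Q := by
  obtain ⟨hfm, hfw⟩ := hf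
  refine (mem_LpClass_iff (by positivity)).2 ⟨hfm, ?_⟩
  rcases hw with ⟨rfl, hw⟩ | ⟨hp1, hw, C, hC⟩
  · obtain ⟨C, hC⟩ := exists_average_le_of_mem_A1 hw
    set m := (volume Q)⁻¹ * ∫⁻ y in Q, ENNReal.ofReal (w y) with hm
    have hm0 : m ≠ 0 := hw.1.average_ne_zero hQ
    have hmtop : m ≠ ∞ := hw.1.average_ne_top hQ
    rw [div_one]
    have h : m * ∫⁻ x in Q, ‖f x‖ₑ ^ p₀ ≤ C * ∫⁻ x in Q, ‖f x‖ₑ ^ p₀ * ENNReal.ofReal (w x) := by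
      rw [← lintegral_const_mul' _ _ hmtop, ← lintegral_const_mul' _ _ ENNReal.coe_ne_top]
      refine lintegral_mono_ae ?_
      filter_upwards [hC Q hQ subset_rfl] with x hx
      rw [mul_left_comm, mul_comm]
      gcongr
    exact ENNReal.lt_top_of_mul_ne_top_right
      (ne_top_of_le_ne_top (ENNReal.mul_ne_top ENNReal.coe_ne_top hfw.ne) h) hm0
  · have hp0 : 0 < p - 1 := by linarith
    have hdual : ∫⁻ x in Q, ENNReal.ofReal (w x) ^ (-1 / (p - 1)) ≠ ∞ := by
      intro htop
      have h := hC Q hQ subset_rfl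
      rw [htop, ENNReal.mul_top (ENNReal.inv_ne_zero.2 hQ.volume_ne_top),
        ENNReal.top_rpow_of_pos hp0, ENNReal.mul_top (hw.average_ne_zero hQ)] at h
      exact ENNReal.coe_ne_top (top_le_iff.1 h)
    calc ∫⁻ x in Q, ‖f x‖ₑ ^ (p₀ / p)
        ≤ ∫⁻ x in Q, (‖f x‖ₑ ^ p₀ * ENNReal.ofReal (w x) +
            ENNReal.ofReal (w x) ^ (-1 / (p - 1))) := by
          refine lintegral_mono_ae ?_
          filter_upwards [hw.pos] with x hx
          set W := ENNReal.ofReal (w x) with hW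
          have hW0 : W ≠ 0 := (ENNReal.ofReal_pos.2 hx).ne'
          have hWtop : W ≠ ∞ := ENNReal.ofReal_ne_top
          set a := ‖f x‖ₑ ^ p₀ * W with ha
          set b := W ^ (-1 / (p - 1)) with hb
          have h1p : 0 ≤ 1 - 1 / p := by
            rw [sub_nonneg, div_le_one (by linarith)]
            exact hp
          calc ‖f x‖ₑ ^ (p₀ / p) = a ^ (1 / p) * b ^ (1 - 1 / p) := by
                rw [ha, hb, ENNReal.mul_rpow_of_nonneg _ _ (by positivity), ← ENNReal.rpow_mul,
                  ← ENNReal.rpow_mul, mul_assoc, ← ENNReal.rpow_add _ _ hW0 hWtop,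
                  show 1 / p + -1 / (p - 1) * (1 - 1 / p) = 0 by field_simp; ring,
                  ENNReal.rpow_zero, mul_one, mul_one_div]
            _ ≤ (a + b) ^ (1 / p) * (a + b) ^ (1 - 1 / p) := by
                gcongr
                · exact le_self_add
                · exact le_add_self
            _ = a + b := by
                rw [← ENNReal.rpow_add_of_nonneg _ _ (by positivity) h1p, add_sub_cancel,
                  ENNReal.rpow_one]
      _ = (∫⁻ x in Q, ‖f x‖ₑ ^ p₀ * ENNReal.ofReal (w x)) +
            ∫⁻ x in Q, ENNReal.ofReal (w x) ^ (-1 / (p - 1)) :=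
          lintegral_add_right' _ (hw.aemeasurable_ofReal.pow_const _)
      _ < ∞ := ENNReal.add_lt_top.2 ⟨hfw, hdual.lt_top⟩

end LocalWeights

theorem theorem3 {𝕜 : Type*} [RCLike 𝕜] {n : ℕ} (Q : Set (Fin n → ℝ))
    (hQ : LocalWeights.IsCube Q) (p₀ : ℝ) (hp₀ : 0 < p₀) :
    (⋃ (r : ℝ) (_ : 0 < r), LocalWeights.A1Majorized 𝕜 r Q) =
        (⋃ (p : ℝ) (_ : 0 < p), LocalWeights.LpClass 𝕜 p Q) ∧
      (⋃ (p : ℝ) (_ : 0 < p), LocalWeights.LpClass 𝕜 p Q) =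
        (⋃ w ∈ LocalWeights.AInfty Q, LocalWeights.WeightedLpClass 𝕜 p₀ w Q) := by
  refine ⟨Set.Subset.antisymm ?_ ?_, Set.Subset.antisymm ?_ ?_⟩ <;> intro f hf
  · obtain ⟨r, hr, hf⟩ := Set.mem_iUnion₂.1 hf
    exact Set.mem_iUnion₂.2 ⟨r, hr, LocalWeights.mem_LpClass_of_mem_A1Majorized hr hf⟩
  · obtain ⟨p, hp, hf⟩ := Set.mem_iUnion₂.1 hf
    exact Set.mem_iUnion₂.2
      ⟨p / 2, half_pos hp, LocalWeights.mem_A1Majorized_of_mem_LpClass hp hQ hf⟩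
  · obtain ⟨p, hp, hf⟩ := Set.mem_iUnion₂.1 hf
    obtain ⟨v, hv, hfv⟩ := LocalWeights.exists_mem_WeightedLpClass_of_mem_A1Majorized (half_pos hp)
      hp₀ hQ (LocalWeights.mem_A1Majorized_of_mem_LpClass hp hQ hf)
    exact Set.mem_iUnion₂.2 ⟨v, hv, hfv⟩
  · obtain ⟨w, hw, hf⟩ := Set.mem_iUnion₂.1 hf
    obtain ⟨p, hp, hw⟩ := Set.mem_iUnion₂.1 hw
    exact Set.mem_iUnion₂.2 ⟨p₀ / p, div_pos hp₀ (by linarith),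
      LocalWeights.mem_LpClass_of_mem_WeightedLpClass hp hp₀ hQ hw hf⟩
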